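/- Let $0<\alpha\le 0.05$, $\epsilon>0$, $N,M\ge 1$, and let $x=(x_1,\dots,x_N)\in\mathbb{R}^N$. Let $\mathbf S=(s_{ij})\in\mathbb{R}^{N\times M}$ be a random matrix whose entries are i.i.d. with the symmetric $\alpha$-stable distribution $S(\alpha,1)$ of unit scale, that is, $E\,e^{\sqrt{-1}\,s_{ij}t}=e^{-|t|^{\alpha}}$ for all $t\in\mathbb{R}$. Let $y_j=\sum_{t=1}^N x_t s_{tj}$ $(1\le j\le M)$ be the linear measurements of $x$. For a coordinate $i\in\{1,\dots,N\}$ define the absolute minimum estimator $$\hat x_{i,\min}=\frac{y_{t}}{s_{it}},\qquad t=\operatorname*{argmin}_{1\le j\le M}\left|\frac{y_j}{s_{ij}}\right| ,$$ and $\theta_i=\Big(\sum_{t\ne i}|x_t|^\alpha\Big)^{1/\alpha}$. **Theorem (Analysis of False Negatives).** Suppose $\theta_i>0$ and $\left(\frac{|x_i|+\epsilon}{\theta_i}\right)^{\alpha/(1-\alpha)}<\frac13$. Then $$\Pr\left(|\hat x_{i,\min}|\le\epsilon,\ |x_i|>\epsilon\right)\le 1-\left[1-\frac34\left|\frac{|x_i|+\epsilon}{\theta_i}\right|^{\frac{\alpha}{1+\alpha}}\left(1-\left|\frac{|x_i|-\epsilon}{|x_i|+\epsilon}\right|^{\frac{\alpha}{1-\alpha}}\right)\right]^M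 .$$ -/

import Mathlib

open MeasureTheory ProbabilityTheory
open scoped Matrix

namespace StableRecovery

/-- `X` has the symmetric `α`-stable distribution with unit scale `S(α, 1)` under `P`:
its characteristic function is `t ↦ exp (-|t| ^ α)`. -/
structure HasUnitStableLaw {Ω : Type*} [MeasurableSpace Ω] (α : ℝ) (X : Ω → ℝ)
    (P : Measure Ω) : Prop where
  aemeasurable : AEMeasurable X P
  charFun_eq : ∀ t : ℝ, charFun (P.map X) t = ((Real.exp (-(|t| ^ α)) : ℝ) : ℂ)

/-- `S` is a random `N × M` design matrix whose entries are i.i.d. samples from `S(α, 1)`. -/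
structure IsStableDesign {Ω : Type*} [MeasurableSpace Ω] {N M : ℕ} (α : ℝ)
    (S : Ω → Matrix (Fin N) (Fin M) ℝ) (P : Measure Ω) : Prop where
  indep : iIndepFun (fun (p : Fin N × Fin M) (ω : Ω) => S ω p.1 p.2) P
  law : ∀ i j, HasUnitStableLaw α (fun ω => S ω i j) P

/-- The ratio statistics `z_{i,j} = y_j / s_{ij}`, where `y = x A` is the vector of linear
measurements of the signal `x` with the design matrix `A = (s_{ij})`. -/
noncomputable def ratioStat {N M : ℕ} (x : Fin N → ℝ) (A : Matrix (Fin N) (Fin M) ℝ)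
    (i : Fin N) (j : Fin M) : ℝ :=
  (x ᵥ* A) j / A i j

/-- An index `t` that minimises `|z t|`. -/
noncomputable def absArgmin {M : ℕ} [NeZero M] (z : Fin M → ℝ) : Fin M :=
  Classical.choose (Finite.exists_min fun j => |z j|)

theorem abs_absArgmin_le {M : ℕ} [NeZero M] (z : Fin M → ℝ) (j : Fin M) :
    |z (absArgmin z)| ≤ |z j| :=
  Classical.choose_spec (Finite.exists_min fun j => |z j|) j

/-- The absolute minimum estimator `x̂_{i,min} = z_{i,t}`, `t = argmin_j |z_{i,j}|`. -/
noncomputable def absMinEstimator {N M : ℕ} [NeZero M] (x : Fin N → ℝ)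
    (A : Matrix (Fin N) (Fin M) ℝ) (i : Fin N) : ℝ :=
  ratioStat x A i (absArgmin (ratioStat x A i))

/-- `θ_i = (∑_{t ≠ i} |x_t| ^ α) ^ (1 / α)`. -/
noncomputable def thetaExcept {N : ℕ} (α : ℝ) (x : Fin N → ℝ) (i : Fin N) : ℝ :=
  (∑ t ∈ Finset.univ.erase i, |x t| ^ α) ^ (1 / α)

end StableRecovery

/-! The estimate can be at most `ε` in modulus only if some ratio `z_j` is, and the ratios come from
independent columns; so it suffices to bound `P(|z_j| ≤ ε)` by the bracketed `q` when `|x_i| > ε`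
(otherwise the event is empty).

By stability, `z_j = (x_i s + θ W) / s` with `s`, `W` independent unit stable variables. Put `A =
(|x_i| + ε)/θ` and `B = (|x_i| - ε)/θ`. For fixed `W = y`, the event confines `s` to one interval
with endpoints `|y|/A` and `|y|/B`, up to sign. Two facts on stable laws then suffice: (1)
`measureReal_Icc_le`: the mass of `[p, q]` with `p > 0` is at most `(2/π)(p^(-α) - q^(-α))`; (2)
`lintegral_abs_rpow_neg_le`: `E|W|^(-α) ≤ Γ(1-α)(2+α)/2`. Integrating (1) over `y` gives `(2/π)(A^α
- B^α) E|W|^(-α)`, and `ratio_constant_le` compares this with `q`.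

For (1), two integrations by parts turn the inversion integral of `exp(-ξ^α)` into `x⁻²` times the
integral of its second derivative against `1 - cos(xξ)`. This derivative is at most `α(1-α)
ξ^(α-2)`, and `1 - cos u ≤ min(u²/2, 2)`. No density is ever constructed: the law is smoothed by the
Poisson kernel at scale `ε`, which multiplies the transform by `exp(-εξ)`, and then `ε → 0`. The
same kernel at the origin, integrated over all scales, yields (2). -/

namespace StableRecovery

open Set Filter Topology Real

/-! ### Poisson smoothing in terms of the characteristic function -/

/-- The cosine transform of a probability law with real characteristic function. -/
lemma integral_cos_sub_of_charFun {μ : Measure ℝ} [IsProbabilityMeasure μ] {g : ℝ → ℝ}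
    (h : ∀ t, charFun μ t = (g t : ℂ)) (x ξ : ℝ) :
    ∫ y, cos ((x - y) * ξ) ∂μ = cos (x * ξ) * g ξ := by
  have hint : Integrable (fun y : ℝ => Complex.exp (ξ * y * Complex.I)) μ := by
    refine Integrable.of_bound (C := 1) (by fun_prop) (ae_of_all _ fun y => ?_)
    rw [← Complex.ofReal_mul, Complex.norm_exp_ofReal_mul_I]
  have h1 := h ξ
  rw [charFun_apply_real] at h1
  have hc : ∫ y, cos (ξ * y) ∂μ = g ξ := by
    have := integral_re hint
    simp only [RCLike.re_to_complex] at this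
    rw [h1, Complex.ofReal_re] at this
    rw [← this]
    refine integral_congr_ae (ae_of_all _ fun y => ?_)
    simp only
    rw [← Complex.ofReal_mul, Complex.exp_ofReal_mul_I_re]
  have hs : ∫ y, sin (ξ * y) ∂μ = 0 := by
    have := integral_im hint
    simp only [RCLike.im_to_complex] at this
    rw [h1, Complex.ofReal_im] at this
    rw [← this]
    refine integral_congr_ae (ae_of_all _ fun y => ?_)
    simp only
    rw [← Complex.ofReal_mul, Complex.exp_ofReal_mul_I_im]
  have ic : Integrable (fun y : ℝ => cos (ξ * y)) μ :=
    Integrable.of_bound (C := 1) (by fun_prop) (ae_of_all _ fun y => abs_cos_le_one _)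
  have is : Integrable (fun y : ℝ => sin (ξ * y)) μ :=
    Integrable.of_bound (C := 1) (by fun_prop) (ae_of_all _ fun y => abs_sin_le_one _)
  have he : ∀ y, cos ((x - y) * ξ) = cos (x * ξ) * cos (ξ * y) + sin (x * ξ) * sin (ξ * y) := by
    intro y
    rw [← cos_sub]; ring_nf
  simp_rw [he]
  rw [integral_add (ic.const_mul _) (is.const_mul _), integral_const_mul, integral_const_mul, hc, hs]
  ring

lemma integrableOn_exp_neg_mul {ε : ℝ} (hε : 0 < ε) :
    IntegrableOn (fun ξ : ℝ => exp (-(ε * ξ))) (Ioi 0) := by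
  simpa [neg_mul] using integrableOn_exp_mul_Ioi (a := -ε) (by linarith) 0

lemma integral_exp_neg_mul_cos {ε : ℝ} (hε : 0 < ε) (d : ℝ) :
    ∫ ξ in Ioi (0 : ℝ), exp (-(ε * ξ)) * cos (d * ξ) = ε / (ε ^ 2 + d ^ 2) := by
  have ha : (-ε + d * Complex.I : ℂ).re < 0 := by simp [hε]
  have hint := integrableOn_exp_mul_complex_Ioi ha 0
  have h1 := integral_exp_mul_complex_Ioi ha 0
  have h2 := integral_re hint
  simp only [RCLike.re_to_complex] at h2
  rw [h1] at h2
  have h3 : ∫ ξ in Ioi (0 : ℝ), exp (-(ε * ξ)) * cos (d * ξ)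
      = ∫ ξ in Ioi (0 : ℝ), (Complex.exp ((-ε + d * Complex.I) * ξ)).re := by
    refine integral_congr_ae (ae_of_all _ fun ξ => ?_)
    simp only [Complex.exp_re]
    simp
  rw [h3, h2]
  simp [Complex.div_re, Complex.normSq_apply]
  ring

/-- A regularised Fourier inversion: the Poisson kernel is the cosine transform of `exp(-εξ)`, and
this damping makes Fubini legitimate. -/
lemma integral_poissonKernel_of_charFun {μ : Measure ℝ} [IsProbabilityMeasure μ] {g : ℝ → ℝ}
    (h : ∀ t, charFun μ t = (g t : ℂ)) {ε : ℝ} (hε : 0 < ε) (x : ℝ) :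
    ∫ y, ε / (ε ^ 2 + (x - y) ^ 2) ∂μ
      = ∫ ξ in Ioi (0 : ℝ), exp (-(ε * ξ)) * (cos (x * ξ) * g ξ) := by
  simp_rw [← integral_exp_neg_mul_cos hε]
  rw [integral_integral_swap]
  · simp_rw [integral_const_mul, integral_cos_sub_of_charFun h]
  · have := (integrable_const (1 : ℝ) (μ := μ)).mul_prod (integrableOn_exp_neg_mul hε)
    refine this.mono (by fun_prop) (ae_of_all _ fun p => ?_)
    simp only [Function.uncurry, norm_mul, one_mul]
    exact mul_le_of_le_one_right (norm_nonneg _) (abs_cos_le_one _)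

lemma one_sub_cos_le_half_sq (u : ℝ) : 1 - cos u ≤ u ^ 2 / 2 := by
  linarith [one_sub_sq_div_two_le_cos (x := u)]

/-! ### The integral of the majorant of `1 - cos` -/

section Majorant

variable {α x : ℝ}

lemma integrableOn_min_sq_mul_rpow (hα₀ : 0 < α) (hα : α < 1) (hx : 0 < x) :
    IntegrableOn (fun ξ : ℝ => min ((x * ξ) ^ 2 / 2) 2 * ξ ^ (α - 2)) (Ioi 0) ∧
    ∫ ξ in Ioi (0 : ℝ), min ((x * ξ) ^ 2 / 2) 2 * ξ ^ (α - 2)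
      = x ^ (1 - α) * 2 ^ (1 + α) / (1 - α ^ 2) := by
  -- The two branches of the minimum meet at `ξ = 2 / x`.
  have hc : 0 < 2 / x := by positivity
  have e1 : EqOn (fun ξ : ℝ => x ^ 2 / 2 * ξ ^ α)
      (fun ξ : ℝ => min ((x * ξ) ^ 2 / 2) 2 * ξ ^ (α - 2)) (Ioc 0 (2 / x)) := by
    intro ξ hξ
    have h2 : x * ξ ≤ 2 := by
      have := hξ.2; rw [le_div_iff₀ hx] at this; linarith
    have h3 : 0 < x * ξ := mul_pos hx hξ.1
    simp only
    rw [min_eq_left (by nlinarith), rpow_sub hξ.1, rpow_two]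
    have := hξ.1.ne'
    field_simp
  have e2 : EqOn (fun ξ : ℝ => 2 * ξ ^ (α - 2))
      (fun ξ : ℝ => min ((x * ξ) ^ 2 / 2) 2 * ξ ^ (α - 2)) (Ioi (2 / x)) := by
    intro ξ hξ
    have h2 : 2 < x * ξ := by
      have := mem_Ioi.1 hξ; rw [div_lt_iff₀ hx] at this; linarith
    simp only
    rw [min_eq_right (by nlinarith)]
  have i1' : IntegrableOn (fun ξ : ℝ => x ^ 2 / 2 * ξ ^ α) (Ioc 0 (2 / x)) := by
    rw [← intervalIntegrable_iff_integrableOn_Ioc_of_le hc.le]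
    exact (intervalIntegral.intervalIntegrable_rpow' (by linarith)).const_mul _
  have i2' : IntegrableOn (fun ξ : ℝ => 2 * ξ ^ (α - 2)) (Ioi (2 / x)) :=
    (integrableOn_Ioi_rpow_of_lt (by linarith) hc).const_mul _
  have i1 := i1'.congr_fun e1 measurableSet_Ioc
  have i2 := i2'.congr_fun e2 measurableSet_Ioi
  rw [← Ioc_union_Ioi_eq_Ioi hc.le]
  refine ⟨i1.union i2, ?_⟩
  rw [setIntegral_union (Ioc_disjoint_Ioi le_rfl) measurableSet_Ioi i1 i2,
    ← setIntegral_congr_fun measurableSet_Ioc e1, ← setIntegral_congr_fun measurableSet_Ioi e2,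
    integral_const_mul, integral_const_mul, integral_Ioi_rpow_of_lt (by linarith) hc,
    ← intervalIntegral.integral_of_le hc.le, integral_rpow (Or.inl (by linarith)),
    zero_rpow (by linarith), div_rpow zero_le_two hx.le, div_rpow zero_le_two hx.le,
    show α - 2 + 1 = α - 1 by ring, rpow_add_one hx.ne', rpow_sub_one hx.ne', rpow_sub hx, rpow_one,
    rpow_add_one two_ne_zero, rpow_add two_pos, rpow_sub_one two_ne_zero, rpow_one]
  have : 0 < x ^ α := by positivity
  have h1 : 1 - α ≠ 0 := by linarith
  have h2 : 1 + α ≠ 0 := by linarith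
  have h3 : α - 1 ≠ 0 := by linarith
  have h4 : α + 1 ≠ 0 := by linarith
  have h5 : 1 - α ^ 2 ≠ 0 := by nlinarith
  field_simp
  ring

end Majorant

/-! ### Cosine transform of the damped characteristic function -/

section DampedCharFun

variable {α ε x : ℝ}

/-- The first derivative, up to sign, of `ξ ↦ exp (-(ε ξ) - ξ ^ α)`. -/
noncomputable def dampedSlope (α ε ξ : ℝ) : ℝ :=
  (ε + α * ξ ^ (α - 1)) * exp (-(ε * ξ) - ξ ^ α)

/-- The second derivative of `ξ ↦ exp (-(ε ξ) - ξ ^ α)`. -/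
noncomputable def dampedCurvature (α ε ξ : ℝ) : ℝ :=
  ((ε + α * ξ ^ (α - 1)) ^ 2 + α * (1 - α) * ξ ^ (α - 2)) * exp (-(ε * ξ) - ξ ^ α)

lemma hasDerivAt_damped {ξ : ℝ} (hξ : 0 < ξ) :
    HasDerivAt (fun ξ : ℝ => exp (-(ε * ξ) - ξ ^ α)) (-dampedSlope α ε ξ) ξ := by
  have h1 := ((((hasDerivAt_id ξ).const_mul ε).neg).sub
    (hasDerivAt_rpow_const (p := α) (Or.inl hξ.ne'))).exp
  refine h1.congr_deriv ?_
  simp [dampedSlope]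
  ring

lemma hasDerivAt_dampedSlope {ξ : ℝ} (hξ : 0 < ξ) :
    HasDerivAt (dampedSlope α ε) (-dampedCurvature α ε ξ) ξ := by
  have h1 := (((hasDerivAt_rpow_const (p := α - 1) (Or.inl hξ.ne')).const_mul α).const_add ε).mul
    (hasDerivAt_damped (ε := ε) (α := α) hξ)
  refine h1.congr_deriv ?_
  simp only [dampedSlope, dampedCurvature, show α - 1 - 1 = α - 2 by ring]
  ring

/-- An antiderivative linking `cos (x ξ)` and `1 - cos (x ξ)` against the damped function. -/
noncomputable def dampedPrimitive (α ε x ξ : ℝ) : ℝ :=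
  exp (-(ε * ξ) - ξ ^ α) * sin (x * ξ) / x + dampedSlope α ε ξ * (1 - cos (x * ξ)) / x ^ 2

lemma hasDerivAt_dampedPrimitive (hx : x ≠ 0) {ξ : ℝ} (hξ : 0 < ξ) :
    HasDerivAt (dampedPrimitive α ε x)
      (exp (-(ε * ξ) - ξ ^ α) * cos (x * ξ) - dampedCurvature α ε ξ * (1 - cos (x * ξ)) / x ^ 2)
      ξ := by
  have hl : HasDerivAt (fun ξ : ℝ => x * ξ) x ξ := by
    simpa using (hasDerivAt_id ξ).const_mul x
  have h1 := (((hasDerivAt_damped (ε := ε) (α := α) hξ).mul hl.sin).div_const x).add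
    (((hasDerivAt_dampedSlope (ε := ε) (α := α) hξ).mul (hl.cos.const_sub 1)).div_const (x ^ 2))
  refine h1.congr_deriv ?_
  field_simp
  ring

lemma damped_le_exp_neg_mul {ξ : ℝ} (hξ : 0 ≤ ξ) :
    exp (-(ε * ξ) - ξ ^ α) ≤ exp (-(ε * ξ)) :=
  exp_le_exp.2 (by linarith [rpow_nonneg hξ α])

lemma damped_le_exp_neg_rpow (hε : 0 < ε) {ξ : ℝ} (hξ : 0 ≤ ξ) :
    exp (-(ε * ξ) - ξ ^ α) ≤ exp (-ξ ^ α) :=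
  exp_le_exp.2 (by linarith [mul_nonneg hε.le hξ])

lemma tendsto_damped_atTop (hε : 0 < ε) :
    Tendsto (fun ξ : ℝ => exp (-(ε * ξ) - ξ ^ α)) atTop (𝓝 0) := by
  have : Tendsto (fun ξ : ℝ => exp (-(ε * ξ))) atTop (𝓝 0) :=
    tendsto_exp_neg_atTop_nhds_zero.comp (tendsto_id.const_mul_atTop hε)
  refine squeeze_zero' (Eventually.of_forall fun _ => (exp_pos _).le) ?_ this
  filter_upwards [eventually_ge_atTop 0] with ξ hξ using damped_le_exp_neg_mul hξ

lemma tendsto_dampedPrimitive_atTop (hε : 0 < ε) (hα : α < 1) :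
    Tendsto (dampedPrimitive α ε x) atTop (𝓝 0) := by
  have h0 := tendsto_damped_atTop (α := α) hε
  have hp : Tendsto (fun ξ : ℝ => ξ ^ (α - 1)) atTop (𝓝 0) := by
    have := tendsto_rpow_neg_atTop (y := 1 - α) (by linarith)
    simpa using this
  have hs : Tendsto (dampedSlope α ε) atTop (𝓝 0) := by
    have := ((hp.const_mul α).const_add ε).mul h0
    rwa [mul_zero] at this
  have b1 : IsBoundedUnder (· ≤ ·) atTop (norm ∘ fun ξ : ℝ => sin (x * ξ)) :=
    isBoundedUnder_of ⟨1, fun ξ => abs_sin_le_one _⟩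
  have b2 : IsBoundedUnder (· ≤ ·) atTop (norm ∘ fun ξ : ℝ => 1 - cos (x * ξ)) :=
    isBoundedUnder_of ⟨2, fun ξ => by
      simp only [Function.comp, norm_eq_abs]
      rw [abs_le]; constructor <;> linarith [neg_one_le_cos (x * ξ), cos_le_one (x * ξ)]⟩
  have := ((h0.zero_mul_isBoundedUnder_le b1).div_const x).add
    ((hs.zero_mul_isBoundedUnder_le b2).div_const (x ^ 2))
  rwa [zero_div, zero_div, add_zero] at this

/-- The slope may blow up like `ξ^(α-1)` at the origin, but `1 - cos(xξ) = O(ξ²)` absorbs it. -/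
lemma continuousWithinAt_dampedPrimitive (hα₀ : 0 < α) :
    ContinuousWithinAt (dampedPrimitive α ε x) (Ici 0) 0 := by
  have hk : Continuous (fun ξ : ℝ => exp (-(ε * ξ) - ξ ^ α)) := by
    have := continuous_id.rpow_const (p := α) (fun _ : ℝ => Or.inr hα₀.le)
    simp only [id] at this
    fun_prop
  have hb : Tendsto (fun ξ : ℝ => ξ ^ (α - 1) * (1 - cos (x * ξ))) (𝓝[Ici 0] 0) (𝓝 0) := by
    have hr : Tendsto (fun ξ : ℝ => x ^ 2 / 2 * ξ ^ (1 + α)) (𝓝[Ici 0] 0) (𝓝 0) := by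
      have := (((continuous_id.rpow_const (p := 1 + α)
        (fun _ : ℝ => Or.inr (by linarith))).const_mul (x ^ 2 / 2)).tendsto 0)
      simp only [id] at this
      rw [zero_rpow (by linarith), mul_zero] at this
      exact this.mono_left nhdsWithin_le_nhds
    refine squeeze_zero' ?_ ?_ hr
    · filter_upwards [self_mem_nhdsWithin] with ξ hξ
      exact mul_nonneg (rpow_nonneg hξ _) (by linarith [cos_le_one (x * ξ)])
    · filter_upwards [self_mem_nhdsWithin] with ξ hξ
      rcases (mem_Ici.1 hξ).eq_or_lt with rfl | hξ
      · simp [zero_rpow (show 1 + α ≠ 0 by linarith)]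
      · calc ξ ^ (α - 1) * (1 - cos (x * ξ)) ≤ ξ ^ (α - 1) * ((x * ξ) ^ 2 / 2) := by
              gcongr; exact one_sub_cos_le_half_sq _
          _ = x ^ 2 / 2 * ξ ^ (1 + α) := by
              rw [show 1 + α = (α - 1) + 2 by ring, rpow_add hξ, rpow_two]; ring
  have hkt := (hk.tendsto 0).mono_left (nhdsWithin_le_nhds (s := Ici 0))
  have hct : Tendsto (fun ξ : ℝ => 1 - cos (x * ξ)) (𝓝[Ici 0] 0) (𝓝 (1 - cos (x * 0))) :=
    ((show Continuous (fun ξ : ℝ => 1 - cos (x * ξ)) by fun_prop).tendsto 0).mono_left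
      nhdsWithin_le_nhds
  have hst : Tendsto (fun ξ : ℝ => sin (x * ξ)) (𝓝[Ici 0] 0) (𝓝 (sin (x * 0))) :=
    ((show Continuous (fun ξ : ℝ => sin (x * ξ)) by fun_prop).tendsto 0).mono_left
      nhdsWithin_le_nhds
  have := ((hkt.mul hst).div_const x).add
    ((((hct.const_mul ε).add (hb.const_mul α)).mul hkt).div_const (x ^ 2))
  have hz : dampedPrimitive α ε x 0 = 0 := by simp [dampedPrimitive]
  rw [ContinuousWithinAt, hz]
  simp only [mul_zero, sin_zero, cos_zero, sub_self, add_zero, zero_div, zero_mul] at this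
  refine this.congr fun ξ => ?_
  simp only [dampedPrimitive, dampedSlope]
  ring

lemma dampedCurvature_nonneg (hα₀ : 0 < α) (hα : α < 1) {ξ : ℝ} (hξ : 0 < ξ) :
    0 ≤ dampedCurvature α ε ξ := by
  have : 0 < 1 - α := by linarith
  unfold dampedCurvature
  positivity

/-- The terms free of `ε` combine to `α ξ^(α-2) ((1-α) + α ξ^α) exp(-ξ^α)`. Since `α ≤ 1/2` gives `α
≤ 1-α`, the last two factors are at most `(1-α)(1 + ξ^α) exp(-ξ^α) ≤ 1-α`. The other terms vanish
with `ε`. -/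
lemma dampedCurvature_le (hα₀ : 0 < α) (hα : α ≤ 1 / 2) (hε : 0 < ε) {ξ : ℝ} (hξ : 0 < ξ) :
    dampedCurvature α ε ξ ≤ α * (1 - α) * ξ ^ (α - 2)
      + (ε ^ 2 * exp (-ξ ^ α) + 2 * ε * α * (ξ ^ (α - 1) * exp (-ξ ^ α))) := by
  have h1 := damped_le_exp_neg_rpow (α := α) hε hξ.le
  have hα1 : 0 < 1 - α := by linarith
  set E := exp (-ξ ^ α) with hE
  have hp : 0 < ξ ^ α := rpow_pos_of_pos hξ _
  have h2 : ((1 - α) + α * ξ ^ α) * E ≤ 1 - α := by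
    have h3 : (1 + ξ ^ α) * E ≤ 1 := by
      rw [hE, exp_neg, ← div_eq_mul_inv, div_le_one (exp_pos _)]
      linarith [add_one_le_exp (ξ ^ α)]
    have hE0 : 0 < E := exp_pos _
    have : ((1 - α) + α * ξ ^ α) * E ≤ (1 - α) * ((1 + ξ ^ α) * E) := by
      rw [← mul_assoc]
      gcongr
      nlinarith
    nlinarith
  have e2 : (ξ ^ (α - 1)) ^ 2 = ξ ^ (α - 2) * ξ ^ α := by
    rw [← rpow_natCast, ← rpow_mul hξ.le, ← rpow_add hξ]; congr 1; push_cast; ring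
  calc dampedCurvature α ε ξ
      ≤ ((ε + α * ξ ^ (α - 1)) ^ 2 + α * (1 - α) * ξ ^ (α - 2)) * E := by
        unfold dampedCurvature; gcongr
    _ = α * ξ ^ (α - 2) * (((1 - α) + α * ξ ^ α) * E)
        + (ε ^ 2 * E + 2 * ε * α * (ξ ^ (α - 1) * E)) := by
        have : (ε + α * ξ ^ (α - 1)) ^ 2
          = ε ^ 2 + 2 * ε * α * ξ ^ (α - 1) + α ^ 2 * (ξ ^ (α - 1)) ^ 2 := by ring
        rw [this, e2]; ring
    _ ≤ α * ξ ^ (α - 2) * (1 - α) + (ε ^ 2 * E + 2 * ε * α * (ξ ^ (α - 1) * E)) := by gcongr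
    _ = _ := by ring

/-- A non-integrable function has integral `0` by convention, so a known nonzero value forces
integrability. -/
lemma integrableOn_exp_neg_rpow (hα₀ : 0 < α) :
    IntegrableOn (fun ξ : ℝ => exp (-ξ ^ α)) (Ioi 0) := by
  by_contra h
  have := integral_exp_neg_rpow hα₀
  rw [integral_undef h] at this
  exact (Gamma_pos_of_pos (show 0 < 1 / α + 1 by positivity)).ne this

lemma integral_rpow_sub_one_mul_exp_neg_rpow (hα₀ : 0 < α) :
    ∫ ξ in Ioi (0 : ℝ), ξ ^ (α - 1) * exp (-ξ ^ α) = 1 / α := by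
  rw [integral_rpow_mul_exp_neg_rpow hα₀ (by linarith)]
  simp [hα₀.ne']

lemma integrableOn_rpow_sub_one_mul_exp_neg_rpow (hα₀ : 0 < α) :
    IntegrableOn (fun ξ : ℝ => ξ ^ (α - 1) * exp (-ξ ^ α)) (Ioi 0) := by
  by_contra h
  have := integral_rpow_sub_one_mul_exp_neg_rpow hα₀
  rw [integral_undef h] at this
  exact (one_div_pos.2 hα₀).ne this

lemma one_sub_cos_le_min (u : ℝ) : 1 - cos u ≤ min (u ^ 2 / 2) 2 :=
  le_min (one_sub_cos_le_half_sq u) (by linarith [neg_one_le_cos u])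

/-- Convexity bound on the cosine transform of `ξ ↦ exp (-(ε ξ) - ξ ^ α)`. -/
lemma integral_damped_mul_cos_le (hα₀ : 0 < α) (hα : α ≤ 1 / 2) (hε : 0 < ε) (hx : 0 < x) :
    ∫ ξ in Ioi (0 : ℝ), exp (-(ε * ξ) - ξ ^ α) * cos (x * ξ)
      ≤ 2 * α * x ^ (-1 - α) + (2 * ε ^ 2 * Gamma (1 / α + 1) + 4 * ε) / x ^ 2 := by
  obtain ⟨hm, hmv⟩ := integrableOn_min_sq_mul_rpow hα₀ (by linarith : α < 1) hx
  have h1 := integrableOn_exp_neg_rpow hα₀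
  have h2 := integrableOn_rpow_sub_one_mul_exp_neg_rpow hα₀
  have h12 : IntegrableOn (fun ξ : ℝ => 2 * ε ^ 2 * exp (-ξ ^ α)
      + 4 * ε * α * (ξ ^ (α - 1) * exp (-ξ ^ α))) (Ioi 0) :=
    (h1.const_mul _).add (h2.const_mul _)
  have hα1 : 0 < 1 - α := by linarith
  -- The leading curvature term is paired with the sharp majorant of `1 - cos`, the terms in `ε`
  -- with the crude bound `2`.
  set D : ℝ → ℝ := fun ξ => (α * (1 - α) * (min ((x * ξ) ^ 2 / 2) 2 * ξ ^ (α - 2))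
    + (2 * ε ^ 2 * exp (-ξ ^ α) + 4 * ε * α * (ξ ^ (α - 1) * exp (-ξ ^ α)))) / x ^ 2 with hD
  have iD : IntegrableOn D (Ioi 0) :=
    ((hm.const_mul _).add h12).div_const _
  have hDv : ∫ ξ in Ioi (0 : ℝ), D ξ = (α * (1 - α) * (x ^ (1 - α) * 2 ^ (1 + α) / (1 - α ^ 2))
      + (2 * ε ^ 2 * Gamma (1 / α + 1) + 4 * ε)) / x ^ 2 := by
    simp only [hD]
    rw [integral_div, integral_add (hm.const_mul _) h12,
      integral_add (h1.const_mul _) (h2.const_mul _), integral_const_mul, integral_const_mul,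
      integral_const_mul, hmv, integral_exp_neg_rpow hα₀,
      integral_rpow_sub_one_mul_exp_neg_rpow hα₀]
    field_simp
  set C : ℝ → ℝ := fun ξ => dampedCurvature α ε ξ * (1 - cos (x * ξ)) / x ^ 2 with hC
  have hCD : ∀ ξ ∈ Ioi (0 : ℝ), 0 ≤ C ξ ∧ C ξ ≤ D ξ := by
    intro ξ hξ
    have hξ : 0 < ξ := hξ
    have c0 : 0 ≤ 1 - cos (x * ξ) := by linarith [cos_le_one (x * ξ)]
    have k0 := dampedCurvature_nonneg (ε := ε) hα₀ (by linarith : α < 1) hξ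
    refine ⟨by simp only [hC]; positivity, ?_⟩
    simp only [hC, hD]
    gcongr
    have c2 : 1 - cos (x * ξ) ≤ 2 := by linarith [neg_one_le_cos (x * ξ)]
    calc dampedCurvature α ε ξ * (1 - cos (x * ξ))
        ≤ (α * (1 - α) * ξ ^ (α - 2) + (ε ^ 2 * exp (-ξ ^ α)
          + 2 * ε * α * (ξ ^ (α - 1) * exp (-ξ ^ α)))) * (1 - cos (x * ξ)) := by
          gcongr; exact dampedCurvature_le hα₀ hα hε hξ
      _ = α * (1 - α) * ((1 - cos (x * ξ)) * ξ ^ (α - 2)) + (ε ^ 2 * exp (-ξ ^ α)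
          + 2 * ε * α * (ξ ^ (α - 1) * exp (-ξ ^ α))) * (1 - cos (x * ξ)) := by ring
      _ ≤ α * (1 - α) * (min ((x * ξ) ^ 2 / 2) 2 * ξ ^ (α - 2)) + (ε ^ 2 * exp (-ξ ^ α)
          + 2 * ε * α * (ξ ^ (α - 1) * exp (-ξ ^ α))) * 2 := by
          gcongr; exact one_sub_cos_le_min _
      _ = _ := by ring
  have hCcont : ContinuousOn C (Ioi 0) := by
    intro ξ hξ
    have hξ' : ξ ≠ 0 := (mem_Ioi.1 hξ).ne'
    have c1 := continuousAt_rpow_const ξ (α - 1) (Or.inl hξ')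
    have c2 := continuousAt_rpow_const ξ (α - 2) (Or.inl hξ')
    have c3 := continuousAt_rpow_const ξ α (Or.inl hξ')
    refine ContinuousAt.continuousWithinAt ?_
    simp only [hC, dampedCurvature]
    fun_prop
  have iC : IntegrableOn C (Ioi 0) := by
    refine Integrable.mono' iD (hCcont.aestronglyMeasurable measurableSet_Ioi) ?_
    filter_upwards [ae_restrict_mem measurableSet_Ioi] with ξ hξ
    rw [norm_of_nonneg (hCD ξ hξ).1]
    exact (hCD ξ hξ).2
  have iK : IntegrableOn (fun ξ : ℝ => exp (-(ε * ξ) - ξ ^ α) * cos (x * ξ)) (Ioi 0) := by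
    refine Integrable.mono' h1 (by fun_prop) ?_
    filter_upwards [ae_restrict_mem measurableSet_Ioi] with ξ hξ
    rw [norm_mul, norm_of_nonneg (exp_pos _).le]
    exact (mul_le_of_le_one_right (exp_pos _).le (abs_cos_le_one _)).trans
      (damped_le_exp_neg_rpow hε (mem_Ioi.1 hξ).le)
  -- The primitive vanishes at both ends, so the cosine integral equals the integral of `C`, which
  -- is the double integration by parts.
  have hftc := integral_Ioi_of_hasDerivAt_of_tendsto
    (continuousWithinAt_dampedPrimitive (ε := ε) (x := x) hα₀)
    (fun ξ hξ => hasDerivAt_dampedPrimitive (α := α) (ε := ε) hx.ne' hξ) (iK.sub iC)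
    (tendsto_dampedPrimitive_atTop hε (by linarith))
  rw [integral_sub iK iC, show dampedPrimitive α ε x 0 = 0 by simp [dampedPrimitive],
    sub_zero, sub_eq_zero] at hftc
  rw [hftc]
  have hle : ∫ ξ in Ioi (0 : ℝ), C ξ ≤ ∫ ξ in Ioi (0 : ℝ), D ξ :=
    setIntegral_mono_on iC iD measurableSet_Ioi fun ξ hξ => (hCD ξ hξ).2
  rw [hDv] at hle
  refine hle.trans ?_
  rw [add_div]
  gcongr
  -- The leading constant comes out as `2α · 2^α / (1 + α)`; Bernoulli's inequality for exponents in
  -- `[0, 1]` reduces it to `2α`.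
  have hb : (2 : ℝ) ^ α ≤ 1 + α := by
    have := rpow_one_add_le_one_add_mul_self (s := 1) (by norm_num) hα₀.le (by linarith : α ≤ 1)
    norm_num at this
    linarith
  rw [rpow_sub hx, rpow_sub hx, rpow_neg_one, rpow_one, rpow_add two_pos, rpow_one,
    show 1 - α ^ 2 = (1 - α) * (1 + α) by ring]
  have hxα : 0 < x ^ α := rpow_pos_of_pos hx _
  have h1α : 0 < 1 + α := by linarith
  rw [show α * (1 - α) * (x / x ^ α * (2 * 2 ^ α) / ((1 - α) * (1 + α))) / x ^ 2
    = 2 * α * (x⁻¹ / x ^ α) * (2 ^ α / (1 + α)) by field_simp]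
  exact mul_le_of_le_one_right (by positivity) ((div_le_one h1α).2 hb)

end DampedCharFun

/-! ### Interval masses and negative moment of a stable law -/

lemma integral_poissonKernel_Icc {ε : ℝ} (hε : 0 < ε) (a b y : ℝ) :
    ∫ x in a..b, ε / (ε ^ 2 + (x - y) ^ 2) = arctan ((b - y) / ε) - arctan ((a - y) / ε) := by
  refine intervalIntegral.integral_eq_sub_of_hasDerivAt
    (f := fun x => arctan ((x - y) / ε)) (fun x _ => ?_) ?_
  · have h := (((hasDerivAt_id x).sub_const y).div_const ε).arctan
    refine h.congr_deriv ?_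
    simp only [id]
    field_simp
  · refine Continuous.intervalIntegrable ?_ _ _
    refine Continuous.div (by fun_prop) (by fun_prop) fun x => ?_
    positivity

section Stable

variable {μ : Measure ℝ} [IsProbabilityMeasure μ] {α : ℝ}

lemma integrable_poissonKernel {ε : ℝ} (hε : 0 < ε) (x : ℝ) :
    Integrable (fun y => ε / (ε ^ 2 + (x - y) ^ 2)) μ := by
  refine Integrable.of_bound (C := ε / ε ^ 2) ?_ (ae_of_all _ fun y => ?_)
  · exact (Measurable.div (by fun_prop) (by fun_prop)).aestronglyMeasurable
  · rw [norm_of_nonneg (by positivity)]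
    gcongr
    nlinarith [sq_nonneg (x - y)]

/-- The Poisson regularisation of a symmetric stable law at scale `ε`. -/
lemma integral_poissonKernel_le (h : ∀ t : ℝ, charFun μ t = ((exp (-(|t| ^ α)) : ℝ) : ℂ))
    (hα₀ : 0 < α) (hα : α ≤ 1 / 2) {ε x : ℝ} (hε : 0 < ε) (hx : 0 < x) :
    ∫ y, ε / (ε ^ 2 + (x - y) ^ 2) ∂μ
      ≤ 2 * α * x ^ (-1 - α) + (2 * ε ^ 2 * Gamma (1 / α + 1) + 4 * ε) / x ^ 2 := by
  refine le_of_eq_of_le ?_ (integral_damped_mul_cos_le hα₀ hα hε hx)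
  rw [integral_poissonKernel_of_charFun h hε]
  refine setIntegral_congr_fun measurableSet_Ioi fun ξ hξ => ?_
  rw [abs_of_pos hξ, sub_eq_add_neg, exp_add]
  ring

/-- Integrate the smoothed law over `[p - δ, q + δ]`. A kernel centred in `[p, q]` keeps at least `2
arctan(δ/ε)` of its total mass `π` there, while the pointwise bound on the smoothed law controls the
integral from above. -/
lemma two_mul_arctan_mul_measureReal_Icc_le
    (h : ∀ t : ℝ, charFun μ t = ((exp (-(|t| ^ α)) : ℝ) : ℂ))
    (hα₀ : 0 < α) (hα : α ≤ 1 / 2) {ε δ p q : ℝ} (hε : 0 < ε) (hδ : 0 < δ) (hp : δ < p)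
    (hpq : p ≤ q) :
    2 * arctan (δ / ε) * μ.real (Icc p q) ≤ 2 * ((p - δ) ^ (-α) - (q + δ) ^ (-α))
      + (q + δ - (p - δ)) * ((2 * ε ^ 2 * Gamma (1 / α + 1) + 4 * ε) / (p - δ) ^ 2) := by
  have hab : p - δ ≤ q + δ := by linarith
  have ha : 0 < p - δ := by linarith
  set c := (2 * ε ^ 2 * Gamma (1 / α + 1) + 4 * ε) with hc
  have hc0 : 0 ≤ c := by
    have : 0 < Gamma (1 / α + 1) := Gamma_pos_of_pos (by positivity)
    positivity
  have hint : Integrable (Function.uncurry fun y x : ℝ => ε / (ε ^ 2 + (x - y) ^ 2))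
      (μ.prod (volume.restrict (Ioc (p - δ) (q + δ)))) := by
    refine Integrable.of_bound (C := ε / ε ^ 2) ?_ (ae_of_all _ fun z => ?_)
    · exact (Measurable.div (by fun_prop) (by fun_prop)).aestronglyMeasurable
    · simp only [Function.uncurry]
      rw [norm_of_nonneg (by positivity)]
      gcongr
      nlinarith [sq_nonneg (z.2 - z.1)]
  have hJ : ∀ y, ∫ x in Ioc (p - δ) (q + δ), ε / (ε ^ 2 + (x - y) ^ 2)
      = arctan ((q + δ - y) / ε) - arctan ((p - δ - y) / ε) := fun y => by
    rw [← integral_poissonKernel_Icc hε, intervalIntegral.integral_of_le hab]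
  have lower : 2 * arctan (δ / ε) * μ.real (Icc p q)
      ≤ ∫ y, (∫ x in Ioc (p - δ) (q + δ), ε / (ε ^ 2 + (x - y) ^ 2)) ∂μ := by
    have : 2 * arctan (δ / ε) * μ.real (Icc p q)
        = ∫ y, (Icc p q).indicator (fun _ => 2 * arctan (δ / ε)) y ∂μ := by
      rw [integral_indicator_const _ measurableSet_Icc, smul_eq_mul, mul_comm]
    rw [this]
    refine integral_mono ((integrable_const _).indicator measurableSet_Icc)
      hint.integral_prod_left fun y => ?_
    simp only [hJ]
    by_cases hy : y ∈ Icc p q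
    · rw [indicator_of_mem hy]
      have h1 : arctan (δ / ε) ≤ arctan ((q + δ - y) / ε) :=
        arctan_strictMono.monotone (by gcongr; linarith [hy.2])
      have h2 : arctan ((p - δ - y) / ε) ≤ arctan (-(δ / ε)) :=
        arctan_strictMono.monotone (by rw [← neg_div]; gcongr; linarith [hy.1])
      rw [arctan_neg] at h2
      linarith
    · rw [indicator_of_notMem hy, sub_nonneg]
      exact arctan_strictMono.monotone (by gcongr)
  refine lower.trans ?_
  rw [integral_integral_swap hint, ← intervalIntegral.integral_of_le hab]
  have i1 : IntervalIntegrable (fun x : ℝ => 2 * α * x ^ (-1 - α)) volume (p - δ) (q + δ) := by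
    refine (intervalIntegral.intervalIntegrable_rpow (Or.inr ?_)).const_mul _
    rw [uIcc_of_le hab]
    exact fun h0 => absurd h0.1 (by linarith)
  have hupper : ∫ x in (p - δ)..(q + δ), (∫ y, ε / (ε ^ 2 + (x - y) ^ 2) ∂μ)
      ≤ ∫ x in (p - δ)..(q + δ), (2 * α * x ^ (-1 - α) + c / (p - δ) ^ 2) := by
    refine intervalIntegral.integral_mono_on hab ?_ (i1.add intervalIntegrable_const) ?_
    · rw [intervalIntegrable_iff_integrableOn_Ioc_of_le hab]
      exact hint.integral_prod_right
    · intro x hx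
      have hx0 : 0 < x := ha.trans_le hx.1
      refine (integral_poissonKernel_le h hα₀ hα hε hx0).trans ?_
      rw [← hc]
      gcongr
      exact hx.1
  refine hupper.trans (le_of_eq ?_)
  rw [intervalIntegral.integral_add i1 intervalIntegrable_const, intervalIntegral.integral_const_mul,
    integral_rpow (Or.inr ⟨by linarith, by
      rw [uIcc_of_le hab]; exact fun h0 => absurd h0.1 (by linarith)⟩),
    intervalIntegral.integral_const, smul_eq_mul, show -1 - α + 1 = -α by ring]
  field_simp
  ring

/-- A symmetric stable law has at most the mass of the density `(2 α / π) x ^ (-1 - α)` on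
intervals of the positive half-line. -/
lemma measureReal_Icc_le (h : ∀ t : ℝ, charFun μ t = ((exp (-(|t| ^ α)) : ℝ) : ℂ))
    (hα₀ : 0 < α) (hα : α ≤ 1 / 2) {p q : ℝ} (hp : 0 < p) (hpq : p ≤ q) :
    μ.real (Icc p q) ≤ 2 / π * (p ^ (-α) - q ^ (-α)) := by
  -- First `ε → 0` with the margin `δ` fixed, so that `2 arctan(δ/ε) → π`; then `δ → 0`.
  have step : ∀ δ : ℝ, 0 < δ → δ < p →
      π * μ.real (Icc p q) ≤ 2 * ((p - δ) ^ (-α) - (q + δ) ^ (-α)) := by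
    intro δ hδ hδp
    have t1 : Tendsto (fun ε : ℝ => 2 * arctan (δ / ε) * μ.real (Icc p q)) (𝓝[>] 0)
        (𝓝 (2 * (π / 2) * μ.real (Icc p q))) := by
      refine (Tendsto.const_mul _ ?_).mul_const _
      have : Tendsto (fun ε : ℝ => δ / ε) (𝓝[>] 0) atTop :=
        tendsto_inv_nhdsGT_zero.const_mul_atTop hδ
      exact (tendsto_arctan_atTop.mono_right nhdsWithin_le_nhds).comp this
    have t2 : Tendsto (fun ε : ℝ => 2 * ((p - δ) ^ (-α) - (q + δ) ^ (-α))
        + (q + δ - (p - δ)) * ((2 * ε ^ 2 * Gamma (1 / α + 1) + 4 * ε) / (p - δ) ^ 2)) (𝓝[>] 0)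
        (𝓝 (2 * ((p - δ) ^ (-α) - (q + δ) ^ (-α)))) := by
      have : Continuous (fun ε : ℝ => 2 * ((p - δ) ^ (-α) - (q + δ) ^ (-α))
        + (q + δ - (p - δ)) * ((2 * ε ^ 2 * Gamma (1 / α + 1) + 4 * ε) / (p - δ) ^ 2)) := by
        fun_prop
      have := (this.tendsto 0).mono_left (nhdsWithin_le_nhds (s := Ioi 0))
      simpa using this
    have := le_of_tendsto_of_tendsto t1 t2 (by
      filter_upwards [self_mem_nhdsWithin] with ε hε
      exact two_mul_arctan_mul_measureReal_Icc_le h hα₀ hα hε hδ hδp hpq)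
    linarith
  have t3 : Tendsto (fun δ : ℝ => 2 * ((p - δ) ^ (-α) - (q + δ) ^ (-α))) (𝓝[>] 0)
      (𝓝 (2 * (p ^ (-α) - q ^ (-α)))) := by
    have : ContinuousAt (fun δ : ℝ => 2 * ((p - δ) ^ (-α) - (q + δ) ^ (-α))) 0 := by
      have c1 : ContinuousAt (fun δ : ℝ => (p - δ) ^ (-α)) 0 :=
        ContinuousAt.rpow_const (by fun_prop) (Or.inl (by simpa using hp.ne'))
      have c2 : ContinuousAt (fun δ : ℝ => (q + δ) ^ (-α)) 0 :=
        ContinuousAt.rpow_const (by fun_prop) (Or.inl (by simpa using (hp.trans_le hpq).ne'))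
      fun_prop
    have := this.tendsto.mono_left (nhdsWithin_le_nhds (s := Ioi 0))
    simpa using this
  have := ge_of_tendsto t3 (by
    filter_upwards [self_mem_nhdsWithin, mem_nhdsWithin_of_mem_nhds (Iio_mem_nhds hp)] with δ h1 h2
    exact step δ h1 h2)
  rw [div_mul_eq_mul_div, le_div_iff₀ pi_pos]
  linarith

lemma map_neg_eq_self (h : ∀ t : ℝ, charFun μ t = ((exp (-(|t| ^ α)) : ℝ) : ℂ)) :
    μ.map (fun y => -y) = μ := by
  have : IsProbabilityMeasure (μ.map (fun y => -y)) := Measure.isProbabilityMeasure_map (by fun_prop)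
  refine Measure.ext_of_charFun (funext fun t => ?_)
  have := charFun_map_mul (μ := μ) (-1) t
  simp only [neg_one_mul] at this
  rw [this, h, h, abs_neg]

lemma measure_Icc_neg (h : ∀ t : ℝ, charFun μ t = ((exp (-(|t| ^ α)) : ℝ) : ℂ)) (p q : ℝ) :
    μ (Icc (-q) (-p)) = μ (Icc p q) := by
  conv_lhs => rw [← map_neg_eq_self h]
  rw [Measure.map_apply (by fun_prop) measurableSet_Icc]
  congr 1
  ext y
  simp

/-- For `e > r > |y|`, `e/(e² + y²) ≥ 1/e - r²/e³`. Integrating against `e^(-α)` over `(r, ∞)` gives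
`(1/α - 1/(2+α)) r^(-α)`, and then `r → |y|`. Strict `r > |y|` keeps `r` positive and so covers `y =
0`, where the left side is `⊤`. -/
lemma ofReal_mul_rpow_le_lintegral (hα₀ : 0 < α) (y : ℝ) :
    ENNReal.ofReal (2 / (α * (2 + α))) * ENNReal.ofReal |y| ^ (-α)
      ≤ ∫⁻ e in Ioi (0 : ℝ), ENNReal.ofReal (e ^ (-α) * (e / (e ^ 2 + (0 - y) ^ 2))) := by
  have step : ∀ r : ℝ, |y| < r → ENNReal.ofReal (2 / (α * (2 + α))) * ENNReal.ofReal r ^ (-α)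
      ≤ ∫⁻ e in Ioi (0 : ℝ), ENNReal.ofReal (e ^ (-α) * (e / (e ^ 2 + (0 - y) ^ 2))) := by
    intro r hr
    have hr0 : 0 < r := (abs_nonneg y).trans_lt hr
    have i1 := integrableOn_Ioi_rpow_of_lt (a := -1 - α) (by linarith) hr0
    have i2 := (integrableOn_Ioi_rpow_of_lt (a := -3 - α) (by linarith) hr0).const_mul (r ^ 2)
    have hpt : ∀ e ∈ Ioi r, 0 ≤ e ^ (-1 - α) - r ^ 2 * e ^ (-3 - α) ∧
        e ^ (-1 - α) - r ^ 2 * e ^ (-3 - α) ≤ e ^ (-α) * (e / (e ^ 2 + (0 - y) ^ 2)) := by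
      intro e he
      have he' : r < e := he
      have he0 : 0 < e := hr0.trans he'
      have e1 : e ^ (-1 - α) = e ^ (-α) * (1 / e) := by
        rw [show -1 - α = -α - 1 by ring, rpow_sub_one he0.ne']; ring
      have e3 : e ^ (-3 - α) = e ^ (-α) * (1 / e ^ 3) := by
        rw [show -3 - α = -α + (-3 : ℤ) by push_cast; ring, rpow_add_intCast he0.ne']
        norm_cast
        simp
      have ep : 0 < e ^ (-α) := rpow_pos_of_pos he0 _
      have hy2 : y ^ 2 ≤ r ^ 2 := sq_le_sq' (by linarith [neg_abs_le y]) (by linarith [le_abs_self y])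
      have hr2 : r ^ 2 ≤ e ^ 2 := by gcongr
      have : e ^ (-1 - α) - r ^ 2 * e ^ (-3 - α) = e ^ (-α) * ((e ^ 2 - r ^ 2) / e ^ 3) := by
        rw [e1, e3]; field_simp
      rw [this]
      constructor
      · have : 0 ≤ e ^ 2 - r ^ 2 := by linarith
        positivity
      · refine mul_le_mul_of_nonneg_left ?_ ep.le
        rw [div_le_div_iff₀ (by positivity) (by positivity)]
        nlinarith [mul_nonneg he0.le (mul_nonneg (sub_nonneg.2 hr2) (sq_nonneg y)),
          mul_nonneg he0.le (mul_nonneg (sq_nonneg e) (sub_nonneg.2 hy2)),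
          mul_nonneg he0.le (mul_nonneg (sq_nonneg r) (sq_nonneg y))]
    have hval : ∫ e in Ioi r, (e ^ (-1 - α) - r ^ 2 * e ^ (-3 - α))
        = 2 / (α * (2 + α)) * r ^ (-α) := by
      rw [integral_sub i1 i2, integral_const_mul, integral_Ioi_rpow_of_lt (by linarith) hr0,
        integral_Ioi_rpow_of_lt (by linarith) hr0, show -1 - α + 1 = -α by ring,
        show -3 - α + 1 = -α + (-2 : ℤ) by push_cast; ring, rpow_add_intCast hr0.ne']
      have : -α + (-2 : ℝ) ≠ 0 := by linarith
      push_cast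
      rw [zpow_neg, zpow_ofNat]
      have : 2 + α ≠ 0 := by linarith
      field_simp
      ring
    calc ENNReal.ofReal (2 / (α * (2 + α))) * ENNReal.ofReal r ^ (-α)
        = ENNReal.ofReal (∫ e in Ioi r, (e ^ (-1 - α) - r ^ 2 * e ^ (-3 - α))) := by
          rw [hval, ENNReal.ofReal_mul (by positivity), ENNReal.ofReal_rpow_of_pos hr0]
      _ = ∫⁻ e in Ioi r, ENNReal.ofReal (e ^ (-1 - α) - r ^ 2 * e ^ (-3 - α)) := by
          refine ofReal_integral_eq_lintegral_ofReal (i1.sub i2) ?_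
          filter_upwards [ae_restrict_mem measurableSet_Ioi] with e he using (hpt e he).1
      _ ≤ ∫⁻ e in Ioi r, ENNReal.ofReal (e ^ (-α) * (e / (e ^ 2 + (0 - y) ^ 2))) :=
          setLIntegral_mono' measurableSet_Ioi fun e he => ENNReal.ofReal_le_ofReal (hpt e he).2
      _ ≤ _ := lintegral_mono_set (Ioi_subset_Ioi hr0.le)
  have t : Tendsto (fun r : ℝ => ENNReal.ofReal (2 / (α * (2 + α))) * ENNReal.ofReal r ^ (-α))
      (𝓝[>] |y|) (𝓝 (ENNReal.ofReal (2 / (α * (2 + α))) * ENNReal.ofReal |y| ^ (-α))) := by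
    refine ENNReal.Tendsto.const_mul ?_ (Or.inr ENNReal.ofReal_ne_top)
    exact ((ENNReal.continuous_rpow_const.comp ENNReal.continuous_ofReal).tendsto _).mono_left
      nhdsWithin_le_nhds
  exact le_of_tendsto t (by filter_upwards [self_mem_nhdsWithin] with r hr using step r hr)

/-- Bound on the moment of order `-α` of a symmetric stable law. -/
lemma lintegral_abs_rpow_neg_le (h : ∀ t : ℝ, charFun μ t = ((exp (-(|t| ^ α)) : ℝ) : ℂ))
    (hα₀ : 0 < α) (hα : α < 1) :
    ∫⁻ y, ENNReal.ofReal |y| ^ (-α) ∂μ ≤ ENNReal.ofReal (Gamma (1 - α) * (2 + α) / 2) := by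
  have hκ : 0 < 2 / (α * (2 + α)) := by positivity
  have hG : 0 < Gamma (1 - α) := Gamma_pos_of_pos (by linarith)
  -- Tonelli twice: the integral over scales `e` produces `Γ(1-α) ξ^(α-1)`, the exact factor that
  -- makes the remaining integral against `exp(-ξ^α)` equal to `1/α`.
  have key : ∫⁻ y, (∫⁻ e in Ioi (0 : ℝ),
      ENNReal.ofReal (e ^ (-α) * (e / (e ^ 2 + (0 - y) ^ 2)))) ∂μ
      = ENNReal.ofReal (Gamma (1 - α) / α) := by
    rw [lintegral_lintegral_swap (by fun_prop)]
    have e1 : ∀ e ∈ Ioi (0 : ℝ),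
        ∫⁻ y, ENNReal.ofReal (e ^ (-α) * (e / (e ^ 2 + (0 - y) ^ 2))) ∂μ
        = ∫⁻ ξ in Ioi (0 : ℝ), ENNReal.ofReal (exp (-ξ ^ α))
          * ENNReal.ofReal (e ^ (1 - α - 1) * exp (-(ξ * e))) := by
      intro e he
      have he0 : 0 < e := he
      have ep : 0 < e ^ (-α) := rpow_pos_of_pos he0 _
      rw [← ofReal_integral_eq_lintegral_ofReal
        ((integrable_poissonKernel he0 0).const_mul _) (ae_of_all _ fun y => by positivity),
        integral_const_mul, integral_poissonKernel_of_charFun h he0, ← integral_const_mul,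
        ofReal_integral_eq_lintegral_ofReal]
      · refine setLIntegral_congr_fun measurableSet_Ioi fun ξ hξ => ?_
        rw [← ENNReal.ofReal_mul (exp_pos _).le, abs_of_pos hξ, zero_mul, cos_zero,
          show 1 - α - 1 = -α by ring, mul_comm ξ e]
        congr 1; ring
      · refine Integrable.const_mul ?_ _
        refine Integrable.mono (integrableOn_exp_neg_mul he0) (by fun_prop) (ae_of_all _ fun ξ => ?_)
        rw [zero_mul, cos_zero, one_mul, norm_mul]
        refine mul_le_of_le_one_right (norm_nonneg _) ?_
        rw [norm_of_nonneg (exp_pos _).le, exp_le_one_iff, neg_nonpos]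
        positivity
      · refine ae_of_all _ fun ξ => ?_
        simp only [zero_mul, cos_zero, one_mul, Pi.zero_apply]
        positivity
    rw [setLIntegral_congr_fun measurableSet_Ioi e1]
    rw [lintegral_lintegral_swap (by fun_prop)]
    have e2 : ∀ ξ ∈ Ioi (0 : ℝ), ∫⁻ e in Ioi (0 : ℝ), ENNReal.ofReal (exp (-ξ ^ α))
          * ENNReal.ofReal (e ^ (1 - α - 1) * exp (-(ξ * e)))
        = ENNReal.ofReal (Gamma (1 - α) * (ξ ^ (α - 1) * exp (-ξ ^ α))) := by
      intro ξ hξ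
      have hξ0 : 0 < ξ := hξ
      have hv := integral_rpow_mul_exp_neg_mul_Ioi (a := 1 - α) (by linarith) hξ0
      rw [lintegral_const_mul _ (by fun_prop), ← ofReal_integral_eq_lintegral_ofReal, hv,
        ← ENNReal.ofReal_mul (exp_pos _).le]
      · rw [one_div, inv_rpow hξ0.le, ← rpow_neg hξ0.le, neg_sub]
        congr 1; ring
      · by_contra hni
        rw [integral_undef hni] at hv
        have : 0 < (1 / ξ) ^ (1 - α) * Gamma (1 - α) := by positivity
        exact this.ne hv
      · filter_upwards [ae_restrict_mem measurableSet_Ioi] with e he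
        have he0 : 0 < e := he
        simp only [Pi.zero_apply]
        positivity
    rw [setLIntegral_congr_fun measurableSet_Ioi e2, ← ofReal_integral_eq_lintegral_ofReal
      ((integrableOn_rpow_sub_one_mul_exp_neg_rpow hα₀).const_mul _), integral_const_mul,
      integral_rpow_sub_one_mul_exp_neg_rpow hα₀, mul_one_div]
    filter_upwards [ae_restrict_mem measurableSet_Ioi] with ξ hξ
    have hξ0 : 0 < ξ := hξ
    simp only [Pi.zero_apply]
    positivity
  have hle := lintegral_mono (μ := μ) fun y => ofReal_mul_rpow_le_lintegral hα₀ y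
  rw [key, lintegral_const_mul _ (by fun_prop)] at hle
  rw [show Gamma (1 - α) * (2 + α) / 2 = Gamma (1 - α) / α / (2 / (α * (2 + α))) by field_simp,
    ENNReal.ofReal_div_of_pos hκ, ENNReal.le_div_iff_mul_le
      (Or.inl (by simpa using hκ)) (Or.inl ENNReal.ofReal_ne_top), mul_comm]
  exact hle

end Stable

/-- `Γ(1) = Γ(2) = 1` and convexity give `Γ(2-α) = (1-α) Γ(1-α) ≤ 1`. -/
lemma Gamma_one_sub_le {α : ℝ} (hα₀ : 0 < α) (hα : α < 1) : Gamma (1 - α) ≤ 1 / (1 - α) := by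
  have h1 : 0 < 1 - α := by linarith
  have hc := convexOn_Gamma.2 (x := 1) (y := 2) (mem_Ioi.2 one_pos) (mem_Ioi.2 two_pos)
    hα₀.le h1.le (by ring)
  simp only [smul_eq_mul, Gamma_one, Gamma_two] at hc
  rw [show α * 1 + (1 - α) * 2 = (1 - α) + 1 by ring, Gamma_add_one h1.ne'] at hc
  rw [le_div_iff₀ h1]
  linarith

/-! ### The ratio of two independent stable variables -/

section Ratio

variable {μ ν : Measure ℝ} [IsProbabilityMeasure μ] [IsProbabilityMeasure ν] {α : ℝ}

/-- An atom at `0` would make the moment of order `-α` infinite. -/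
lemma ae_ne_zero_of_stable (h : ∀ t : ℝ, charFun μ t = ((exp (-(|t| ^ α)) : ℝ) : ℂ))
    (hα₀ : 0 < α) (hα : α < 1) : ∀ᵐ y ∂μ, y ≠ 0 := by
  have hfin : ∫⁻ y, ENNReal.ofReal |y| ^ (-α) ∂μ ≠ ⊤ :=
    ((lintegral_abs_rpow_neg_le h hα₀ hα).trans_lt ENNReal.ofReal_lt_top).ne
  filter_upwards [ae_lt_top (by fun_prop) hfin] with y hy h0
  rw [h0, abs_zero, ENNReal.ofReal_zero, ENNReal.zero_rpow_of_neg (by linarith)] at hy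
  exact lt_irrefl _ hy

/-- The triangle inequality locates `|s|`. If `x s` and `θ y` had the same sign they could not
cancel, giving a ratio of modulus at least `|x| > ε`; so the sign of `s` is determined and only one
of the two symmetric intervals counts. The point `0` appears because division by zero returns `0`.
-/
lemma ratio_section_subset {x θ ε y : ℝ} (hθ : 0 < θ) (hε : 0 < ε) (hx : ε < |x|) :
    {s : ℝ | |(x * s + θ * y) / s| ≤ ε} ⊆
        {0} ∪ Icc (|y| / ((|x| + ε) / θ)) (|y| / ((|x| - ε) / θ)) ∨
    {s : ℝ | |(x * s + θ * y) / s| ≤ ε} ⊆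
        {0} ∪ Icc (-(|y| / ((|x| - ε) / θ))) (-(|y| / ((|x| + ε) / θ))) := by
  have hA : 0 < |x| + ε := by linarith
  have hB : 0 < |x| - ε := by linarith
  have mem : ∀ s : ℝ, s ≠ 0 → |(x * s + θ * y) / s| ≤ ε →
      |s| ∈ Icc (|y| / ((|x| + ε) / θ)) (|y| / ((|x| - ε) / θ)) := by
    intro s hs h
    rw [abs_div, div_le_iff₀ (abs_pos.2 hs)] at h
    have h1 : |θ * y| ≤ |x * s + θ * y| + |x * s| := by
      calc |θ * y| = |(x * s + θ * y) - x * s| := by ring_nf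
        _ ≤ _ := abs_sub _ _
    have h2 : |x * s| ≤ |x * s + θ * y| + |θ * y| := by
      calc |x * s| = |(x * s + θ * y) - θ * y| := by ring_nf
        _ ≤ _ := abs_sub _ _
    rw [abs_mul, abs_mul, abs_of_pos hθ] at h1 h2
    constructor
    · rw [div_div_eq_mul_div, div_le_iff₀ hA]; nlinarith
    · rw [div_div_eq_mul_div, le_div_iff₀ hB]; nlinarith
  have sgn : ∀ s : ℝ, s ≠ 0 → |(x * s + θ * y) / s| ≤ ε → x * s * y ≤ 0 := by
    intro s hs h
    rw [abs_div, div_le_iff₀ (abs_pos.2 hs)] at h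
    by_contra! hpos
    have hs' : 0 < |s| := abs_pos.2 hs
    have h1 : |x * s| ≤ |x * s + θ * y| := by
      rw [← sq_le_sq]
      nlinarith [sq_nonneg (θ * y), mul_pos hθ hpos]
    rw [abs_mul] at h1
    nlinarith
  rcases le_or_gt (x * y) 0 with hxy | hxy
  · by_cases h0 : x * y = 0
    · left
      intro s hs
      have hy : y = 0 := by
        rcases mul_eq_zero.1 h0 with h | h
        · rw [h, abs_zero] at hx; linarith
        · exact h
      by_cases hs0 : s = 0
      · exact Or.inl hs0
      · have := mem s hs0 hs
        simp [hy] at this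
        exact absurd this hs0
    · left
      intro s hs
      by_cases hs0 : s = 0
      · exact Or.inl hs0
      · right
        have h1 := sgn s hs0 hs
        have hlt : x * y < 0 := lt_of_le_of_ne hxy h0
        have : 0 ≤ s := by
          by_contra! hneg
          nlinarith [mul_pos_of_neg_of_neg hlt hneg]
        have h2 := mem s hs0 hs
        rwa [abs_of_nonneg this] at h2
  · right
    intro s hs
    by_cases hs0 : s = 0
    · exact Or.inl hs0
    · right
      have h1 := sgn s hs0 hs
      have : s ≤ 0 := by
        by_contra! hpos
        nlinarith [mul_pos hxy hpos]
      have h2 := mem s hs0 hs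
      rw [abs_of_nonpos this] at h2
      exact ⟨by linarith [h2.2], by linarith [h2.1]⟩

lemma measurableSet_ratio (x θ ε : ℝ) :
    MeasurableSet {p : ℝ × ℝ | |(x * p.1 + θ * p.2) / p.1| ≤ ε} :=
  measurableSet_le (by fun_prop) measurable_const

/-- Concentration bound for the ratio statistic of a pair of independent stable variables. -/
lemma prod_ratio_le (hμ : ∀ t : ℝ, charFun μ t = ((exp (-(|t| ^ α)) : ℝ) : ℂ))
    (hν : ∀ t : ℝ, charFun ν t = ((exp (-(|t| ^ α)) : ℝ) : ℂ))
    (hα₀ : 0 < α) (hα : α ≤ 1 / 2) {x θ ε : ℝ} (hθ : 0 < θ) (hε : 0 < ε) (hx : ε < |x|) :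
    (μ.prod ν) {p : ℝ × ℝ | |(x * p.1 + θ * p.2) / p.1| ≤ ε}
      ≤ ENNReal.ofReal (2 / π * (((|x| + ε) / θ) ^ α - ((|x| - ε) / θ) ^ α)
        * (Gamma (1 - α) * (2 + α) / 2)) := by
  have hB : 0 < (|x| - ε) / θ := div_pos (by linarith) hθ
  have hBA : (|x| - ε) / θ ≤ (|x| + ε) / θ := by gcongr; linarith
  have hA : 0 < (|x| + ε) / θ := hB.trans_le hBA
  set A := (|x| + ε) / θ with hAdef
  set B := (|x| - ε) / θ with hBdef
  have hAB0 : 0 ≤ 2 / π * (A ^ α - B ^ α) := by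
    have : B ^ α ≤ A ^ α := by gcongr
    have := pi_pos
    apply mul_nonneg (by positivity); linarith
  rw [Measure.prod_apply_symm (measurableSet_ratio x θ ε)]
  have hz : μ {0} = 0 := by
    have := ae_ne_zero_of_stable hμ hα₀ (by linarith)
    rw [ae_iff] at this
    simpa using this
  have hsec : ∀ y : ℝ, y ≠ 0 →
      μ ((fun s => (s, y)) ⁻¹' {p : ℝ × ℝ | |(x * p.1 + θ * p.2) / p.1| ≤ ε})
        ≤ ENNReal.ofReal (2 / π * (A ^ α - B ^ α)) * ENNReal.ofReal |y| ^ (-α) := by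
    intro y hy
    have hy0 : 0 < |y| := abs_pos.2 hy
    have hIcc : μ (Icc (|y| / A) (|y| / B))
        ≤ ENNReal.ofReal (2 / π * (A ^ α - B ^ α)) * ENNReal.ofReal |y| ^ (-α) := by
      rw [← ofReal_measureReal, ENNReal.ofReal_rpow_of_pos hy0, ← ENNReal.ofReal_mul hAB0]
      refine ENNReal.ofReal_le_ofReal ((measureReal_Icc_le hμ hα₀ hα (by positivity)
        (by gcongr)).trans (le_of_eq ?_))
      rw [div_rpow hy0.le hA.le, div_rpow hy0.le hB.le, rpow_neg hA.le, rpow_neg hB.le,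
        div_inv_eq_mul, div_inv_eq_mul]
      ring
    have hun : ∀ I : Set ℝ, μ ({0} ∪ I) ≤ μ I := fun I =>
      (measure_union_le _ _).trans (by rw [hz, zero_add])
    rcases ratio_section_subset (y := y) hθ hε hx with h | h
    · exact ((measure_mono h).trans (hun _)).trans hIcc
    · refine ((measure_mono h).trans (hun _)).trans ?_
      rw [measure_Icc_neg hμ]
      exact hIcc
  calc ∫⁻ y, μ ((fun s => (s, y)) ⁻¹' {p : ℝ × ℝ | |(x * p.1 + θ * p.2) / p.1| ≤ ε}) ∂ν
      ≤ ∫⁻ y, ENNReal.ofReal (2 / π * (A ^ α - B ^ α)) * ENNReal.ofReal |y| ^ (-α) ∂ν := by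
        refine lintegral_mono_ae ?_
        filter_upwards [ae_ne_zero_of_stable hν hα₀ (by linarith)] with y hy using hsec y hy
    _ ≤ ENNReal.ofReal (2 / π * (A ^ α - B ^ α))
        * ENNReal.ofReal (Gamma (1 - α) * (2 + α) / 2) := by
        rw [lintegral_const_mul _ (by fun_prop)]
        gcongr
        exact lintegral_abs_rpow_neg_le hν hα₀ (by linarith)
    _ = _ := (ENNReal.ofReal_mul hAB0).symm

end Ratio

/-! ### Comparison with the stated constant and exponents -/

lemma ratio_constant_le {α A B : ℝ} (hα₀ : 0 < α) (hα : α ≤ 0.05) (hB : 0 < B) (hBA : B ≤ A)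
    (hA : A ≤ 1) :
    2 / π * (A ^ α - B ^ α) * (Gamma (1 - α) * (2 + α) / 2)
      ≤ 3 / 4 * A ^ (α / (1 + α)) * (1 - (B / A) ^ (α / (1 - α))) := by
  have hA0 : 0 < A := hB.trans_le hBA
  have h1 : 0 < 1 - α := by norm_num at hα; linarith
  have hr : B / A ≤ 1 := (div_le_one hA0).2 hBA
  have hr0 : 0 < B / A := div_pos hB hA0
  have e1 : A ^ α - B ^ α = A ^ α * (1 - (B / A) ^ α) := by
    rw [div_rpow hB.le hA0.le]
    have : 0 < A ^ α := rpow_pos_of_pos hA0 _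
    field_simp
  -- For bases in `(0, 1]` a smaller exponent gives a larger power: lowering that of `A` and raising
  -- that of `B / A` both weaken the bound.
  have e2 : A ^ α ≤ A ^ (α / (1 + α)) :=
    rpow_le_rpow_of_exponent_ge hA0 hA (div_le_self hα₀.le (by linarith))
  have e3 : (B / A) ^ (α / (1 - α)) ≤ (B / A) ^ α :=
    rpow_le_rpow_of_exponent_ge hr0 hr (by rw [le_div_iff₀ h1]; nlinarith)
  have e4 : (B / A) ^ α ≤ 1 := rpow_le_one hr0.le hr hα₀.le
  -- With `α ≤ 1/20`, `Γ(1-α) ≤ 20/19` and `2 + α ≤ 41/20`; then `π > 3` is enough.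
  have e5 : 2 / π * (Gamma (1 - α) * (2 + α) / 2) ≤ 3 / 4 := by
    have hG : Gamma (1 - α) ≤ 20 / 19 := by
      refine (Gamma_one_sub_le hα₀ (by linarith)).trans ?_
      rw [div_le_div_iff₀ h1 (by norm_num)]
      norm_num at hα; linarith
    have hG0 : 0 < Gamma (1 - α) := Gamma_pos_of_pos h1
    have : Gamma (1 - α) * (2 + α) ≤ 20 / 19 * (41 / 20) := by
      gcongr
      norm_num at hα; linarith
    rw [div_mul_eq_mul_div, div_le_iff₀ pi_pos]
    linarith [pi_gt_three]
  rw [e1]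
  calc 2 / π * (A ^ α * (1 - (B / A) ^ α)) * (Gamma (1 - α) * (2 + α) / 2)
      = 2 / π * (Gamma (1 - α) * (2 + α) / 2) * A ^ α * (1 - (B / A) ^ α) := by ring
    _ ≤ 3 / 4 * A ^ (α / (1 + α)) * (1 - (B / A) ^ (α / (1 - α))) := by
        have : 0 ≤ 1 - (B / A) ^ α := by linarith
        gcongr

/-! ### Independence of columns, and a single column -/

lemma iIndepFun_curry {Ω ι κ : Type*} [MeasurableSpace Ω] {P : Measure Ω} {X : ι → κ → Ω → ℝ}
    (mX : ∀ i j, Measurable (X i j)) (h : iIndepFun (fun (p : ι × κ) ω => X p.1 p.2 ω) P) :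
    iIndepFun (fun i ω j => X i j ω) P := by
  have := h.isProbabilityMeasure
  have hpm : ∀ i j, IsProbabilityMeasure (P.map (X i j)) :=
    fun i j => Measure.isProbabilityMeasure_map (mX i j).aemeasurable
  rw [iIndepFun_iff_map_fun_eq_infinitePi_map (by fun_prop)]
  have h1 := h.map_fun_eq_infinitePi_map fun p : ι × κ => mX p.1 p.2
  have h2 := Measure.infinitePi_map_curry fun i j => P.map (X i j)
  rw [← h1, Measure.map_map (by fun_prop) (by fun_prop)] at h2
  refine h2.trans ?_
  congr 1
  funext i
  exact ((h.precomp (g := fun j => (i, j)) (Prod.mk_right_injective i)).map_fun_eq_infinitePi_map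
    (mX i)).symm

section Column

variable {Ω : Type*} [MeasurableSpace Ω] {P : Measure Ω} {N : ℕ} {α : ℝ}

/-- The normalised interference `θ⁻¹ ∑_{t ≠ i} x_t X_t` is again a unit stable variable. -/
lemma charFun_map_interference {X : Fin N → Ω → ℝ} (mX : ∀ t, Measurable (X t))
    (hX : iIndepFun X P)
    (hlaw : ∀ t, ∀ u : ℝ, charFun (P.map (X t)) u = ((exp (-(|u| ^ α)) : ℝ) : ℂ))
    (hα₀ : 0 < α) (x : Fin N → ℝ) (i : Fin N) (hθ : 0 < thetaExcept α x i) (u : ℝ) :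
    charFun (P.map (fun ω => (thetaExcept α x i)⁻¹ * ∑ t ∈ Finset.univ.erase i, x t * X t ω)) u
      = ((exp (-(|u| ^ α)) : ℝ) : ℂ) := by
  set θ := thetaExcept α x i with hθdef
  have hpow : θ ^ α = ∑ t ∈ Finset.univ.erase i, |x t| ^ α := by
    rw [hθdef, thetaExcept, ← rpow_mul (Finset.sum_nonneg fun t _ => by positivity),
      one_div_mul_cancel hα₀.ne', rpow_one]
  have hI : iIndepFun (fun t ω => x t * X t ω) P :=
    hX.comp (fun t s => x t * s) fun t => by fun_prop
  rw [charFun_map_mul_comp (by fun_prop), (hI.restrict _).charFun_map_fun_finsetSum_eq_prod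
    fun t _ => by fun_prop, Finset.prod_apply]
  have hfac : ∀ t, charFun (P.map (fun ω => x t * X t ω)) (θ⁻¹ * u)
      = ((exp (-(|x t * (θ⁻¹ * u)| ^ α)) : ℝ) : ℂ) := fun t => by
    rw [charFun_map_mul_comp (mX t).aemeasurable, hlaw]
  rw [Finset.prod_congr rfl fun t _ => hfac t, ← Complex.ofReal_prod, ← exp_sum]
  congr 2
  have hterm : ∀ t, |x t * (θ⁻¹ * u)| ^ α = |x t| ^ α * |θ⁻¹ * u| ^ α := fun t => by
    rw [abs_mul, mul_rpow (abs_nonneg _) (abs_nonneg _)]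
  simp_rw [hterm]
  rw [Finset.sum_neg_distrib, ← Finset.sum_mul, ← hpow, abs_mul, mul_rpow (abs_nonneg _) (abs_nonneg _),
    abs_of_pos (inv_pos.2 hθ), inv_rpow hθ.le, mul_inv_cancel_left₀ (rpow_pos_of_pos hθ _).ne']

lemma measure_column_ratio_le [IsProbabilityMeasure P] {X : Fin N → Ω → ℝ} (mX : ∀ t, Measurable (X t))
    (hX : iIndepFun X P)
    (hlaw : ∀ t, ∀ u : ℝ, charFun (P.map (X t)) u = ((exp (-(|u| ^ α)) : ℝ) : ℂ))
    (hα₀ : 0 < α) (hα : α ≤ 1 / 2) (x : Fin N → ℝ) (i : Fin N) (hθ : 0 < thetaExcept α x i)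
    {ε : ℝ} (hε : 0 < ε) (hx : ε < |x i|) :
    P {ω | |(∑ t, x t * X t ω) / X i ω| ≤ ε}
      ≤ ENNReal.ofReal (2 / π * (((|x i| + ε) / thetaExcept α x i) ^ α
        - ((|x i| - ε) / thetaExcept α x i) ^ α) * (Gamma (1 - α) * (2 + α) / 2)) := by
  classical
  set θ := thetaExcept α x i with hθdef
  set W : Ω → ℝ := fun ω => θ⁻¹ * ∑ t ∈ Finset.univ.erase i, x t * X t ω with hW
  have mW : Measurable W := by fun_prop
  have hind : IndepFun (X i) W P := by
    -- The `i`-th entry stays unscaled while the others carry their weights, so that one independent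
    -- family contains both `X i` and the summands of `W`.
    have h1 := hX.comp (fun t s => if t = i then s else x t * s) fun t => by
      by_cases h : t = i <;> simp only [h, if_true, if_false] <;> fun_prop
    have h2 := h1.indepFun_finsetSum_of_notMem (fun t => by
      by_cases h : t = i
      · simpa [h, Function.comp_def] using mX i
      · simpa [h, Function.comp_def] using (mX t).const_mul (x t))
      (Finset.notMem_erase i Finset.univ)
    have h3 := h2.symm.comp measurable_id (measurable_const_mul θ⁻¹)
    convert h3 using 1
    · funext ω; simp
    · funext ω
      simp only [hW, Function.comp, Finset.sum_apply]
      congr 1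
      refine Finset.sum_congr rfl fun t ht => ?_
      simp [Finset.ne_of_mem_erase ht]
  have hlawW := charFun_map_interference mX hX hlaw hα₀ x i hθ
  have := Measure.isProbabilityMeasure_map (μ := P) (mX i).aemeasurable
  have := Measure.isProbabilityMeasure_map (μ := P) mW.aemeasurable
  refine le_of_eq_of_le ?_ (prod_ratio_le (μ := P.map (X i)) (ν := P.map W) (hlaw i) hlawW hα₀ hα
    hθ hε hx)
  rw [← (indepFun_iff_map_prod_eq_prod_map_map (mX i).aemeasurable mW.aemeasurable).1 hind,
    Measure.map_apply ((mX i).prodMk mW) (measurableSet_ratio _ _ _)]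
  congr 1
  ext ω
  simp only [mem_ofPred_eq, mem_preimage, hW]
  rw [mul_inv_cancel_left₀ hθ.ne', Finset.add_sum_erase _ (fun t => x t * X t ω) (Finset.mem_univ i)]

end Column

/-- At least one of `M` independent events of probability at most `q` occurs with probability at
most `1 - (1 - q) ^ M`. -/
lemma measureReal_exists_le {Ω : Type*} [MeasurableSpace Ω] {P : Measure Ω}
    [IsProbabilityMeasure P] {M : ℕ} {Z : Fin M → Ω → ℝ} (mZ : ∀ j, Measurable (Z j))
    (hZ : iIndepFun Z P) {E : Set ℝ} (hE : MeasurableSet E) {q : ℝ} (hq : q ≤ 1)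
    (h : ∀ j, P.real (Z j ⁻¹' E) ≤ q) :
    P.real {ω | ∃ j, Z j ω ∈ E} ≤ 1 - (1 - q) ^ M := by
  have hmeas : MeasurableSet {ω | ∃ j, Z j ω ∈ E} := by
    rw [ofPred_exists]
    exact MeasurableSet.iUnion fun j => mZ j hE
  have hcompl : {ω | ∃ j, Z j ω ∈ E}ᶜ = ⋂ j ∈ Finset.univ, Z j ⁻¹' Eᶜ := by
    ext ω; simp
  have h1 : P.real ({ω | ∃ j, Z j ω ∈ E}ᶜ) = ∏ j, P.real (Z j ⁻¹' Eᶜ) := by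
    rw [hcompl, measureReal_def, hZ.measure_inter_preimage_eq_mul Finset.univ fun _ _ => hE.compl,
      ENNReal.toReal_prod]
    rfl
  have h2 : (1 - q) ^ M ≤ ∏ j, P.real (Z j ⁻¹' Eᶜ) := by
    calc (1 - q) ^ M = ∏ _j : Fin M, (1 - q) := by simp
      _ ≤ _ := Finset.prod_le_prod (fun _ _ => by linarith) fun j _ => by
        rw [preimage_compl, probReal_compl_eq_one_sub (mZ j hE)]
        linarith [h j]
  rw [probReal_compl_eq_one_sub hmeas] at h1
  linarith

end StableRecovery

/-! ### Assembly over the independent columns -/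

theorem mainTheorem4 {Ω : Type*} [MeasurableSpace Ω] (P : Measure Ω) [IsProbabilityMeasure P]
    {N M : ℕ} [NeZero M] (α ε : ℝ) (x : Fin N → ℝ) (S : Ω → Matrix (Fin N) (Fin M) ℝ)
    (i : Fin N)
    (hα₀ : 0 < α) (hα : α ≤ 0.05) (hε : 0 < ε)
    (hS : StableRecovery.IsStableDesign α S P)
    (hθ : 0 < StableRecovery.thetaExcept α x i)
    (hsmall : ((|x i| + ε) / StableRecovery.thetaExcept α x i) ^ (α / (1 - α)) < 1 / 3) :
    P.real {ω | |StableRecovery.absMinEstimator x (S ω) i| ≤ ε ∧ ε < |x i|} ≤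
      1 - (1 - 3 / 4 * |(|x i| + ε) / StableRecovery.thetaExcept α x i| ^ (α / (1 + α)) *
        (1 - |(|x i| - ε) / (|x i| + ε)| ^ (α / (1 - α)))) ^ M := by
  have hα' : α ≤ 1 / 20 := by norm_num at hα ⊢; exact hα
  have hα1 : 0 < 1 - α := by linarith
  have hsum : 0 < |x i| + ε := by positivity
  set θ := StableRecovery.thetaExcept α x i with hθdef
  set A := (|x i| + ε) / θ with hAdef
  have hA0 : 0 < A := div_pos hsum hθ
  -- The smallness hypothesis enters only through this: `A > 1` would make its power at least `1`.
  have hA1 : A ≤ 1 := by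
    by_contra! h
    have := Real.one_le_rpow h.le (div_nonneg hα₀.le hα1.le)
    linarith
  have hr1 : |(|x i| - ε) / (|x i| + ε)| ≤ 1 := by
    rw [abs_div, abs_of_pos hsum, div_le_one hsum, abs_le]
    constructor <;> linarith [abs_nonneg (x i)]
  rw [abs_of_pos hA0]
  set ρ := |(|x i| - ε) / (|x i| + ε)| ^ (α / (1 - α)) with hρdef
  have hρ0 : 0 ≤ ρ := by positivity
  have hρ1 : ρ ≤ 1 := Real.rpow_le_one (abs_nonneg _) hr1 (div_nonneg hα₀.le hα1.le)
  have hAp0 : 0 ≤ A ^ (α / (1 + α)) := by positivity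
  have hAp1 : A ^ (α / (1 + α)) ≤ 1 := Real.rpow_le_one hA0.le hA1 (by positivity)
  set q := 3 / 4 * A ^ (α / (1 + α)) * (1 - ρ) with hq
  have hq0 : 0 ≤ q := mul_nonneg (by positivity) (by linarith)
  have hq1 : q ≤ 1 := by nlinarith [mul_nonneg hAp0 hρ0]
  by_cases hx : ε < |x i|
  swap
  · have : {ω | |StableRecovery.absMinEstimator x (S ω) i| ≤ ε ∧ ε < |x i|} = ∅ := by
      ext ω; simp [hx]
    rw [this, measureReal_empty, sub_nonneg]
    exact pow_le_one₀ (by linarith) (by linarith)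
  have hdiff : 0 < |x i| - ε := by linarith
  -- The entries are only a.e. measurable, so measurable versions replace them; this preserves laws
  -- and independence.
  set Y : Fin M → Fin N → Ω → ℝ := fun j t => (hS.law t j).aemeasurable.mk with hY
  have mY : ∀ j t, Measurable (Y j t) := fun j t => (hS.law t j).aemeasurable.measurable_mk
  have hSY : ∀ j t, (fun ω => S ω t j) =ᵐ[P] Y j t := fun j t => (hS.law t j).aemeasurable.ae_eq_mk
  have hYind : iIndepFun (fun (p : Fin M × Fin N) ω => Y p.1 p.2 ω) P := by
    have h1 := hS.indep.precomp (g := Prod.swap) Prod.swap_injective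
    exact h1.congr fun p => hSY p.1 p.2
  have hYlaw : ∀ j t u, charFun (P.map (Y j t)) u = ((Real.exp (-(|u| ^ α)) : ℝ) : ℂ) := by
    intro j t u
    rw [← Measure.map_congr (hSY j t)]
    exact (hS.law t j).charFun_eq u
  set Z : Fin M → Ω → ℝ := fun j ω => (∑ t, x t * Y j t ω) / Y j i ω with hZ
  have mZ : ∀ j, Measurable (Z j) := fun j => by fun_prop
  have hZind : iIndepFun Z P :=
    (StableRecovery.iIndepFun_curry mY hYind).comp (fun _ c => (∑ t, x t * c t) / c i)
      fun _ => by fun_prop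
  set E : Set ℝ := {z | |z| ≤ ε} with hE
  have mE : MeasurableSet E := measurableSet_le (by fun_prop) measurable_const
  have hZq : ∀ j, P.real (Z j ⁻¹' E) ≤ q := by
    intro j
    have hcol := StableRecovery.measure_column_ratio_le (mY j)
      (hYind.precomp (g := fun t => (j, t)) (Prod.mk_right_injective j)) (hYlaw j) hα₀
      (by linarith) x i hθ hε hx
    have hB : 0 < (|x i| - ε) / θ := div_pos hdiff hθ
    have hBA : (|x i| - ε) / θ ≤ A := by rw [hAdef]; gcongr; linarith
    have hc := StableRecovery.ratio_constant_le hα₀ hα hB hBA hA1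
    rw [hAdef, div_div_div_cancel_right₀ hθ.ne', ← abs_of_pos (div_pos hdiff hsum), ← hρdef,
      ← hAdef, ← hq] at hc
    refine ENNReal.toReal_le_of_le_ofReal hq0 (hcol.trans (ENNReal.ofReal_le_ofReal ?_))
    exact hc
  refine le_trans ?_ (StableRecovery.measureReal_exists_le mZ hZind mE hq1 hZq)
  refine ENNReal.toReal_mono (measure_ne_top _ _) (measure_mono_ae ?_)
  have hall : ∀ᵐ ω ∂P, ∀ j t, S ω t j = Y j t ω := by
    rw [ae_all_iff]; intro j; rw [ae_all_iff]; intro t; exact hSY j t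
  filter_upwards [hall] with ω hω hmem
  -- The estimator is itself one of the `M` ratios.
  refine ⟨StableRecovery.absArgmin (StableRecovery.ratioStat x (S ω) i), ?_⟩
  have := hmem.1
  change |_| ≤ ε
  simpa [hZ, StableRecovery.absMinEstimator, StableRecovery.ratioStat, Matrix.vecMul, dotProduct, hω]
    using this
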